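/- For a continuous random variable or vector $V$ with density $f_V$ (with respect to Lebesgue measure), let $h(V)=E[-\log f_V(V)]$ be its differential entropy (natural logarithm), and for jointly continuous $U,V$ let $h(U\mid V)=E\bigl[-\log\frac{f_{U,V}(U,V)}{f_V(V)}\bigr]$ and $I(U;V)=h(U)+h(V)-h(U,V)$. Weak Balog–Szemerédi–Gowers lemma. Let $X,Y$ be real random variables with a joint density, and suppose that, for some $K\ge 1$, $$I(X;Y)\le \log K \quad(\text{equivalently } h(X,Y)\ge h(X)+h(Y)-\log K),\qquad h(X+Y)\le \tfrac12 h(X)+\tfrac12 h(Y)+\log K .$$ Let $X_1,X_2$ be conditionally independent versions of $X$ given $Y$, that is, $(X_1,Y)$ and $(X_2,Y)$ have the same law as $(X,Y)$, and $X_1,X_2$ are conditionally independent given $Y$. Assume that the differential entropies of $X$, $Y$, $(X,Y)$, $X+Y$ and $(X_1-X_2,Y)$ exist and are finite. Then $$h(X_1-X_2\mid Y)\le h(X)+4\log K .$$ -/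

import Mathlib

open MeasureTheory ProbabilityTheory

noncomputable section

/-- Differential entropy `h(X) = E[-log f(X)]`, where `f` is the density of `X` with respect to
the volume (Lebesgue) measure of `E`; the logarithm is the natural one. It is meaningful under
`HasFiniteDiffEntropy X P`. -/
def diffEntropy {Ω E : Type*} [MeasurableSpace Ω] [MeasureSpace E] (X : Ω → E) (P : Measure Ω) :
    ℝ :=
  ∫ ω, -Real.log (pdf X P volume (X ω)).toReal ∂P

/-- `X` is continuous (it has a density) and its differential entropy exists and is finite. -/
structure HasFiniteDiffEntropy {Ω E : Type*} [MeasurableSpace Ω] [MeasureSpace E]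
    (X : Ω → E) (P : Measure Ω) : Prop where
  hasPDF : HasPDF X P volume
  integrable_log : Integrable (fun ω => Real.log (pdf X P volume (X ω)).toReal) P

/-- Conditional differential entropy `h(X | Y) = E[-log f(X | Y)]`, with the conditional density
`f(x | y) = f(x, y) / f(y)`. -/
def condDiffEntropy {Ω E F : Type*} [MeasurableSpace Ω] [MeasureSpace E] [MeasureSpace F]
    (X : Ω → E) (Y : Ω → F) (P : Measure Ω) : ℝ :=
  ∫ ω, -Real.log ((pdf (fun ω' => (X ω', Y ω')) P volume (X ω, Y ω)).toReal /
    (pdf Y P volume (Y ω)).toReal) ∂P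

/-- Mutual information of continuous random variables, `I(X ; Y) = h(X) + h(Y) - h(X, Y)`. -/
def mutualInfo {Ω E F : Type*} [MeasurableSpace Ω] [MeasureSpace E] [MeasureSpace F]
    (X : Ω → E) (Y : Ω → F) (P : Measure Ω) : ℝ :=
  diffEntropy X P + diffEntropy Y P - diffEntropy (fun ω => (X ω, Y ω)) P

/-- `X₁` and `X₂` are conditionally independent versions of `X` given `Y`: each `(Xᵢ, Y)` has the
law of `(X, Y)`, and the conditional law of `(X₁, X₂)` given `Y` is the product of the conditional
laws of `X₁` and of `X₂` given `Y`. -/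
structure IsCondIndepVersions {Ω : Type*} [MeasurableSpace Ω] (X₁ X₂ X Y : Ω → ℝ)
    (P : Measure Ω) [IsFiniteMeasure P] : Prop where
  identDistrib_fst : IdentDistrib (fun ω => (X₁ ω, Y ω)) (fun ω => (X ω, Y ω)) P P
  identDistrib_snd : IdentDistrib (fun ω => (X₂ ω, Y ω)) (fun ω => (X ω, Y ω)) P P
  condIndep : condDistrib (fun ω => (X₁ ω, X₂ ω)) Y P =ᵐ[P.map Y]
    Kernel.prod (condDistrib X₁ Y P) (condDistrib X₂ Y P)

end

/-!
The discrete entropy proof of the weak Balog–Szemerédi–Gowers lemma runs as follows. Let `Y'` be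
such that `Y` and `Y'` are conditionally independent versions of each other given `(X₁, X₂)`, and
put `D = X₁ - X₂ = (X₁ + Y') - (X₂ + Y')`. Since `D` is a function of `(X₁, X₂)` and also of
`(X₁ + Y', X₂ + Y')`, submodularity of entropy gives
`h(D, Y) ≤ h(X₁, X₂) - h(X₁, X₂, Y) + h(X₁ + Y', X₂ + Y', Y)`. Bounding the joint entropies of
`(X₁, X₂)` and of `(X₁ + Y', X₂ + Y', Y)` by sums of entropies and using
`h(X₁, X₂, Y) = 2 h(X, Y) - h(Y)` one gets
`h(D, Y) + 2 h(X, Y) ≤ 2 h(X) + 2 h(Y) + 2 h(X + Y)` (`diffEntropy_sub_le`), and the two hypotheses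
on `I(X; Y)` and `h(X + Y)` finish the proof.

The intermediate entropies need not be known to be finite, so the inequality is proved in one
stroke by Gibbs' inequality. Write `f, g, s, p, q` for the densities of `X`, `Y`, `X + Y`, `(X, Y)`,
`(D, Y)`, write `k(x₁, x₂, y) = p(x₁, y) p(x₂, y) / g(y)` for that of `(X₁, X₂, Y)` and `r` for
that of `(X₁, X₂)`. Under the law of `(X₁, X₂, Y, Y')` (`condIndepCopies`, with density
`k(x₁, x₂, y) k(x₁, x₂, y') / r(x₁, x₂)`), the two likelihood ratios
`f(x₁) f(x₂) / r(x₁, x₂)` and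
`r(x₁, x₂) s(x₁ + y') s(x₂ + y') g(y) / (q(x₁ - x₂, y) k(x₁, x₂, y'))`
both have expectation at most `1`
(`lintegral_condIndepCopies_product_ratio_le_one`, `lintegral_condIndepCopies_sum_ratio_le_one`).
In the sum of their logarithms `r` cancels, and the expectation of what is left is the difference
of the two sides of the entropy inequality; it is at most `0` because `log t ≤ t - 1`.
-/

/-! ### Conditionally independent copies of a random variable with a density -/

section CondIndepCopies

variable {α β : Type*} [MeasurableSpace α] [MeasurableSpace β]

/-- The density `a ↦ ∫ h(a, b) dν(b)` of the first marginal of a joint density `h`. -/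
noncomputable def marginalDensity (ν : Measure β) (h : α → β → ENNReal) (a : α) : ENNReal :=
  ∫⁻ b, h a b ∂ν

/-- The conditional law of the second coordinate given the first one, for a joint density `h`:
the kernel with density `h(a, b) / ∫ h(a, b') dν(b')` with respect to `ν`. It is the zero measure
at the points `a` where the marginal density is `0` or `∞`. -/
noncomputable def condDensityKernel (ν : Measure β) [SFinite ν] (h : α → β → ENNReal) :
    Kernel α β :=
  (Kernel.const α ν).withDensity fun a b => h a b / marginalDensity ν h a

/-- For a joint density `h` of `(A, B)`, the law of `(A, B, B')`, where `B` and `B'` are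
conditionally independent given `A` and `(A, B')` has the law of `(A, B)`. -/
noncomputable def condIndepCopies (μ : Measure α) (ν : Measure β) [SFinite ν]
    (h : α → β → ENNReal) : Measure (α × β × β) :=
  (μ.withDensity (marginalDensity ν h)) ⊗ₘ (condDensityKernel ν h ×ₖ condDensityKernel ν h)

variable {μ : Measure α} {ν : Measure β} {h : α → β → ENNReal}

/-- Division by the marginal density can be undone almost everywhere: where the marginal vanishes,
so does almost every value of the joint density. -/
lemma marginalDensity_mul_div_ae (hh : Measurable (Function.uncurry h)) {a : α}
    (ha : marginalDensity ν h a ≠ ⊤) :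
    ∀ᵐ b ∂ν, marginalDensity ν h a * (h a b / marginalDensity ν h a) = h a b := by
  by_cases h0 : marginalDensity ν h a = 0
  · have := (lintegral_eq_zero_iff (μ := ν) (hh.of_uncurry_left (x := a))).1 h0
    filter_upwards [this] with b hb
    simp [h0, show h a b = 0 from hb]
  · exact Filter.Eventually.of_forall fun b => ENNReal.mul_div_cancel h0 ha

variable [SFinite ν]

lemma measurable_marginalDensity (hh : Measurable (Function.uncurry h)) :
    Measurable (marginalDensity ν h) :=
  hh.lintegral_prod_right'

lemma measurable_uncurry_div_marginalDensity (hh : Measurable (Function.uncurry h)) :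
    Measurable (Function.uncurry fun a b => h a b / marginalDensity ν h a) :=
  hh.div ((measurable_marginalDensity hh).comp measurable_fst)

lemma lintegral_condDensityKernel (hh : Measurable (Function.uncurry h)) (a : α) {F : β → ENNReal}
    (hF : Measurable F) :
    ∫⁻ b, F b ∂(condDensityKernel ν h a) = ∫⁻ b, h a b / marginalDensity ν h a * F b ∂ν := by
  rw [condDensityKernel, Kernel.lintegral_withDensity _
    (measurable_uncurry_div_marginalDensity hh) a hF, Kernel.const_apply]

lemma isFiniteKernel_condDensityKernel (hh : Measurable (Function.uncurry h)) :
    IsFiniteKernel (condDensityKernel ν h) := by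
  refine ⟨1, ENNReal.one_lt_top, fun a => ?_⟩
  rw [← lintegral_one, lintegral_condDensityKernel hh a measurable_const]
  simp_rw [mul_one, div_eq_mul_inv]
  rw [lintegral_mul_const _ (hh.of_uncurry_left (x := a)), ← div_eq_mul_inv]
  exact ENNReal.div_self_le_one

lemma lintegral_withDensity_marginalDensity (hh : Measurable (Function.uncurry h))
    {G : α → β → ENNReal} (hG : Measurable (Function.uncurry G))
    (hm : ∀ᵐ a ∂μ, marginalDensity ν h a ≠ ⊤) :
    ∫⁻ a, ∫⁻ b, h a b / marginalDensity ν h a * G a b ∂ν ∂(μ.withDensity (marginalDensity ν h)) =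
      ∫⁻ a, ∫⁻ b, h a b * G a b ∂ν ∂μ := by
  have hd := measurable_uncurry_div_marginalDensity (ν := ν) hh
  have hi : Measurable fun a => ∫⁻ b, h a b / marginalDensity ν h a * G a b ∂ν :=
    Measurable.lintegral_prod_right' (hd.mul hG)
  rw [lintegral_withDensity_eq_lintegral_mul _ (measurable_marginalDensity hh) hi]
  refine lintegral_congr_ae ?_
  filter_upwards [hm] with a ha
  have hg : Measurable fun b => h a b / marginalDensity ν h a * G a b :=
    hd.of_uncurry_left.mul hG.of_uncurry_left
  rw [Pi.mul_apply, ← lintegral_const_mul _ hg]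
  refine lintegral_congr_ae ?_
  filter_upwards [marginalDensity_mul_div_ae hh ha] with b hb
  rw [← mul_assoc, hb]

lemma map_fst_withDensity (hh : Measurable (Function.uncurry h)) :
    ((μ.prod ν).withDensity (Function.uncurry h)).map Prod.fst =
      μ.withDensity (marginalDensity ν h) := by
  refine Measure.ext_of_lintegral _ fun F hF => ?_
  have hhF : Measurable fun z : α × β => Function.uncurry h z * F z.1 := hh.mul (by fun_prop)
  rw [lintegral_map hF measurable_fst,
    lintegral_withDensity_eq_lintegral_mul _ (measurable_marginalDensity hh) hF,
    lintegral_withDensity_eq_lintegral_mul _ hh (by fun_prop)]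
  refine (lintegral_prod _ hhF.aemeasurable).trans (lintegral_congr fun a => ?_)
  exact lintegral_mul_const (F a) (hh.of_uncurry_left (x := a))

lemma map_swap_withDensity [SFinite μ] {f : α × β → ENNReal} (hf : Measurable f) :
    ((μ.prod ν).withDensity f).map Prod.swap =
      (ν.prod μ).withDensity (fun z => f z.swap) := by
  refine Measure.ext_of_lintegral _ fun F hF => ?_
  rw [lintegral_map hF measurable_swap, lintegral_withDensity_eq_lintegral_mul _ hf (by fun_prop),
    lintegral_withDensity_eq_lintegral_mul _ (by fun_prop) hF, ← lintegral_prod_swap]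
  rfl

/-- The joint law is the composition of the first marginal with the conditional law. -/
lemma withDensity_compProd_condDensityKernel [SFinite μ] (hh : Measurable (Function.uncurry h))
    (hm : ∀ᵐ a ∂μ, marginalDensity ν h a ≠ ⊤) :
    (μ.withDensity (marginalDensity ν h)) ⊗ₘ condDensityKernel ν h =
      (μ.prod ν).withDensity (Function.uncurry h) := by
  have := isFiniteKernel_condDensityKernel (ν := ν) hh
  refine Measure.ext_of_lintegral _ fun F hF => ?_
  rw [Measure.lintegral_compProd hF, lintegral_withDensity_eq_lintegral_mul _ hh hF,
    lintegral_prod _ (hh.mul hF).aemeasurable]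
  have hc (a : α) := lintegral_condDensityKernel (ν := ν) hh a
    (F := fun b => F (a, b)) (by fun_prop)
  simp_rw [hc]
  exact lintegral_withDensity_marginalDensity hh (G := fun a b => F (a, b)) hF hm

lemma lintegral_condIndepCopies [SFinite μ] (hh : Measurable (Function.uncurry h))
    (hm : ∀ᵐ a ∂μ, marginalDensity ν h a ≠ ⊤) {F : α × β × β → ENNReal} (hF : Measurable F) :
    ∫⁻ z, F z ∂(condIndepCopies μ ν h) =
      ∫⁻ a, ∫⁻ b, h a b * ∫⁻ b', h a b' / marginalDensity ν h a * F (a, b, b') ∂ν ∂ν ∂μ := by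
  have := isFiniteKernel_condDensityKernel (ν := ν) hh
  have hd := measurable_uncurry_div_marginalDensity (ν := ν) hh
  rw [condIndepCopies, Measure.lintegral_compProd hF,
    ← lintegral_withDensity_marginalDensity hh _ hm]
  · refine lintegral_congr fun a => ?_
    rw [Kernel.lintegral_prod _ _ _ (by fun_prop),
      lintegral_condDensityKernel hh]
    · refine lintegral_congr fun b => ?_
      rw [lintegral_condDensityKernel hh a (by fun_prop)]
    · exact Measurable.lintegral_prod_right' (f := fun z : β × β => F (a, z)) (by fun_prop)
  · refine Measurable.lintegral_prod_right' (f := fun z : (α × β) × β =>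
      h z.1.1 z.2 / marginalDensity ν h z.1.1 * F (z.1.1, z.1.2, z.2)) ?_
    exact (hd.comp (f := fun z : (α × β) × β => (z.1.1, z.2)) (by fun_prop)).mul (by fun_prop)

lemma condIndepCopies_eq_withDensity [SFinite μ] (hh : Measurable (Function.uncurry h))
    (hm : ∀ᵐ a ∂μ, marginalDensity ν h a ≠ ⊤) :
    condIndepCopies μ ν h = (μ.prod (ν.prod ν)).withDensity
      fun z => h z.1 z.2.1 * (h z.1 z.2.2 / marginalDensity ν h z.1) := by
  have hd := measurable_uncurry_div_marginalDensity (ν := ν) hh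
  have h1 : Measurable fun z : α × β × β => h z.1 z.2.1 :=
    hh.comp (f := fun z : α × β × β => (z.1, z.2.1)) (by fun_prop)
  have h2 : Measurable fun z : α × β × β => h z.1 z.2.2 / marginalDensity ν h z.1 :=
    hd.comp (f := fun z : α × β × β => (z.1, z.2.2)) (by fun_prop)
  refine Measure.ext_of_lintegral _ fun F hF => ?_
  have h3 := (h1.mul h2).mul hF
  rw [lintegral_condIndepCopies hh hm hF]
  refine Eq.trans ?_ (lintegral_withDensity_eq_lintegral_mul _ (h1.mul h2) hF).symm
  rw [lintegral_prod _ h3.aemeasurable]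
  refine lintegral_congr fun a => ?_
  have h4 := h3.comp (measurable_prodMk_left (x := a))
  refine Eq.trans (lintegral_congr fun b => ?_) (lintegral_prod _ h4.aemeasurable).symm
  have h5 : Measurable fun b' => h a b' / marginalDensity ν h a * F (a, b, b') :=
    hd.of_uncurry_left.mul (by fun_prop)
  rw [← lintegral_const_mul _ h5]
  simp [mul_assoc]

lemma map_snd_condIndepCopies [SFinite μ] (hh : Measurable (Function.uncurry h))
    (hm : ∀ᵐ a ∂μ, marginalDensity ν h a ≠ ⊤) :
    (condIndepCopies μ ν h).map (fun z => (z.1, z.2.2)) =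
      (μ.prod ν).withDensity (Function.uncurry h) := by
  have hd := measurable_uncurry_div_marginalDensity (ν := ν) hh
  refine Measure.ext_of_lintegral _ fun F hF => ?_
  rw [lintegral_map hF (by fun_prop), lintegral_condIndepCopies hh hm (by fun_prop),
    lintegral_withDensity_eq_lintegral_mul _ hh hF, lintegral_prod _ (hh.mul hF).aemeasurable]
  refine lintegral_congr_ae ?_
  filter_upwards [hm] with a ha
  have ha' : Measurable fun b => h a b / marginalDensity ν h a * F (a, b) :=
    hd.of_uncurry_left.mul (by fun_prop)
  rw [lintegral_mul_const _ (hh.of_uncurry_left (x := a))]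
  change marginalDensity ν h a * _ = _
  rw [← lintegral_const_mul _ ha']
  refine lintegral_congr_ae ?_
  filter_upwards [marginalDensity_mul_div_ae hh ha] with b hb
  rw [← mul_assoc, hb]
  rfl

lemma map_fst_condIndepCopies [SFinite μ] (hh : Measurable (Function.uncurry h))
    (hm : ∀ᵐ a ∂μ, marginalDensity ν h a ≠ ⊤) :
    (condIndepCopies μ ν h).map (fun z => (z.1, z.2.1)) =
      (μ.prod ν).withDensity (Function.uncurry h) := by
  have := isFiniteKernel_condDensityKernel (ν := ν) hh
  rw [← map_snd_condIndepCopies hh hm]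
  -- The two copies are exchangeable.
  refine Measure.ext_of_lintegral _ fun F hF => ?_
  rw [lintegral_map hF (by fun_prop), lintegral_map hF (by fun_prop), condIndepCopies,
    Measure.lintegral_compProd (by fun_prop), Measure.lintegral_compProd (by fun_prop)]
  refine lintegral_congr fun a => ?_
  rw [Kernel.lintegral_prod _ _ _ (by fun_prop), Kernel.lintegral_prod_symm _ _ _ (by fun_prop)]

end CondIndepCopies

/-! ### Laws with densities, and an expectation bound -/

lemma ae_ne_zero_and_ne_top_of_eq_withDensity {E : Type*} [MeasurableSpace E] {μ ρ : Measure E}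
    [IsFiniteMeasure ρ] {f : E → ENNReal} (hf : Measurable f) (hρ : ρ = μ.withDensity f) :
    ∀ᵐ x ∂ρ, f x ≠ 0 ∧ f x ≠ ⊤ := by
  have hfin : ∫⁻ x, f x ∂μ ≠ ⊤ := by
    rw [← setLIntegral_univ, ← withDensity_apply _ MeasurableSet.univ, ← hρ]
    exact measure_ne_top _ _
  rw [hρ, ae_withDensity_iff hf]
  filter_upwards [ae_lt_top hf hfin] with x hx h0 using ⟨h0, hx.ne⟩

lemma ae_marginalDensity_ne_top {α β : Type*} [MeasurableSpace α] [MeasurableSpace β]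
    {μ : Measure α} {ν : Measure β} [SFinite ν] {h : α → β → ENNReal}
    (hh : Measurable (Function.uncurry h))
    (hfin : ((μ.prod ν).withDensity (Function.uncurry h)) Set.univ ≠ ⊤) :
    ∀ᵐ a ∂μ, marginalDensity ν h a ≠ ⊤ := by
  rw [withDensity_apply _ MeasurableSet.univ, setLIntegral_univ,
    lintegral_prod _ hh.aemeasurable] at hfin
  filter_upwards [ae_lt_top (measurable_marginalDensity hh) hfin] with a ha using ha.ne

/-- Gibbs' inequality in the form used below. The hypothesis `hφ` comes from
`log u + log v ≤ (u - 1) + (v - 1)`; only the sum `φ` of the two logarithms has to be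
integrable. -/
lemma integral_nonpos_of_le_add_sub_two {E : Type*} [MeasurableSpace E] {μ : Measure E}
    [IsProbabilityMeasure μ] {φ : E → ℝ} {u v : E → ENNReal} (hφi : Integrable φ μ)
    (hu : Measurable u) (hv : Measurable v) (hu1 : ∫⁻ x, u x ∂μ ≤ 1) (hv1 : ∫⁻ x, v x ∂μ ≤ 1)
    (hφ : ∀ᵐ x ∂μ, φ x ≤ (u x).toReal + (v x).toReal - 2) : ∫ x, φ x ∂μ ≤ 0 := by
  have key {w : E → ENNReal} (hw : Measurable w) (hw1 : ∫⁻ x, w x ∂μ ≤ 1) :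
      Integrable (fun x => (w x).toReal) μ ∧ ∫ x, (w x).toReal ∂μ ≤ 1 := by
    have hfin := (hw1.trans_lt ENNReal.one_lt_top).ne
    refine ⟨integrable_toReal_of_lintegral_ne_top hw.aemeasurable hfin, ?_⟩
    rw [integral_toReal hw.aemeasurable (ae_lt_top hw hfin)]
    exact ENNReal.toReal_mono ENNReal.one_ne_top hw1
  obtain ⟨hui, hu2⟩ := key hu hu1
  obtain ⟨hvi, hv2⟩ := key hv hv1
  have huv : Integrable (fun x => (u x).toReal + (v x).toReal) μ := hui.add hvi
  have h := integral_mono_ae hφi (huv.sub (integrable_const 2)) hφ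
  simp only [Pi.sub_apply] at h
  rw [integral_sub huv (integrable_const 2), integral_add hui hvi] at h
  simp only [integral_const, probReal_univ, one_smul] at h
  linarith

/-! ### The two normalisation bounds -/

section Bounds

variable {h : ℝ × ℝ → ℝ → ENNReal}

/-- The likelihood ratio of the product of the marginals of `(X₁, X₂)` to its law has
expectation at most `1`. -/
lemma lintegral_condIndepCopies_product_ratio_le_one (hh : Measurable (Function.uncurry h))
    (hm : ∀ᵐ x, marginalDensity volume h x ≠ ⊤) {f : ℝ → ENNReal} (hf : Measurable f)
    (hf1 : ∫⁻ x, f x = 1) :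
    ∫⁻ z, f z.1.1 * f z.1.2 / marginalDensity volume h z.1
      ∂(condIndepCopies volume volume h) ≤ 1 := by
  have hr := measurable_marginalDensity (ν := volume) hh
  let A : ℝ × ℝ → ENNReal := fun x => f x.1 * f x.2 / marginalDensity volume h x
  have hA : Measurable A := by unfold A; fun_prop
  calc ∫⁻ z, A z.1 ∂(condIndepCopies volume volume h)
      = ∫⁻ x, A x ∂(((condIndepCopies volume volume h).map
          fun z => (z.1, z.2.1)).map Prod.fst) := by
        rw [lintegral_map hA measurable_fst, lintegral_map (by fun_prop) (by fun_prop)]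
    _ = ∫⁻ x, marginalDensity volume h x * A x := by
        rw [map_fst_condIndepCopies hh hm, map_fst_withDensity hh,
          lintegral_withDensity_eq_lintegral_mul _ hr hA]
        rfl
    _ ≤ ∫⁻ x : ℝ × ℝ, f x.1 * f x.2 := lintegral_mono fun x => ENNReal.mul_div_le
    _ = 1 := by
        rw [Measure.volume_eq_prod, lintegral_prod_mul hf.aemeasurable hf.aemeasurable, hf1,
          one_mul]

lemma lintegral_autocorrelation {s : ℝ → ENNReal} (hs : Measurable s) (hs1 : ∫⁻ t, s t = 1) :
    ∫⁻ d, ∫⁻ t, s (d + t) * s t = 1 := by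
  rw [lintegral_lintegral_swap (by fun_prop)]
  have (t : ℝ) : ∫⁻ d, s (d + t) * s t = s t := by
    rw [lintegral_mul_const _ (by fun_prop), lintegral_add_right_eq_self s t, hs1, one_mul]
  simp_rw [this, hs1]

/-- The likelihood ratio behind the submodularity step has expectation at most `1`. The
copy `y'` is integrated out first: `∫ s(x₁ + y') s(x₂ + y') dy'` is a probability density
evaluated at `x₁ - x₂`, so that the remaining integral only involves the law of `(X₁ - X₂, Y)`,
with density `q`. -/
lemma lintegral_condIndepCopies_sum_ratio_le_one (hh : Measurable (Function.uncurry h))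
    (hm : ∀ᵐ x, marginalDensity volume h x ≠ ⊤) {s g : ℝ → ENNReal} {q : ℝ × ℝ → ENNReal}
    (hs : Measurable s) (hg : Measurable g) (hq : Measurable q)
    (hs1 : ∫⁻ t, s t = 1) (hg1 : ∫⁻ y, g y = 1)
    (hlaw : ((volume : Measure ((ℝ × ℝ) × ℝ)).withDensity (Function.uncurry h)).map
      (fun t => (t.1.1 - t.1.2, t.2)) = volume.withDensity q) :
    ∫⁻ z, marginalDensity volume h z.1 *
        (s (z.1.1 + z.2.2) * s (z.1.2 + z.2.2) * (g z.2.1 / q (z.1.1 - z.1.2, z.2.1))) /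
        h z.1 z.2.2 ∂(condIndepCopies volume volume h) ≤ 1 := by
  have hr := measurable_marginalDensity (ν := volume) hh
  let ρ : ℝ → ENNReal := fun d => ∫⁻ t, s (d + t) * s t
  have hρ : Measurable ρ := Measurable.lintegral_prod_right' (f := fun z : ℝ × ℝ =>
    s (z.1 + z.2) * s z.2) (by fun_prop)
  let G : ℝ × ℝ → ENNReal := fun w => g w.2 / q w
  have hG : Measurable G := by unfold G; fun_prop
  have hcorr (x : ℝ × ℝ) : ∫⁻ y', s (x.1 + y') * s (x.2 + y') = ρ (x.1 - x.2) := by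
    simp only [ρ]
    rw [← lintegral_add_left_eq_self (fun t => s (x.1 - x.2 + t) * s t) x.2]
    refine lintegral_congr fun t => ?_
    congr 2
    ring
  have hH : Measurable fun z : (ℝ × ℝ) × ℝ × ℝ => h z.1 z.2.2 :=
    hh.comp (f := fun z : (ℝ × ℝ) × ℝ × ℝ => (z.1, z.2.2)) (by fun_prop)
  have hρG : Measurable fun w : ℝ × ℝ => ρ w.1 * G w := by fun_prop
  have hρG' : Measurable fun t : (ℝ × ℝ) × ℝ =>
    Function.uncurry h t * (ρ (t.1.1 - t.1.2) * G (t.1.1 - t.1.2, t.2)) := by fun_prop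
  calc _ = ∫⁻ x, ∫⁻ y, h x y * ∫⁻ y', h x y' / marginalDensity volume h x *
          (marginalDensity volume h x * (s (x.1 + y') * s (x.2 + y') * G (x.1 - x.2, y)) /
            h x y') := lintegral_condIndepCopies hh hm (by fun_prop)
    _ ≤ ∫⁻ x, ∫⁻ y, h x y * ∫⁻ y', s (x.1 + y') * s (x.2 + y') * G (x.1 - x.2, y) := by
        refine lintegral_mono fun x => lintegral_mono fun y =>
          mul_le_mul_right (lintegral_mono fun y' => ?_) _
        set w := s (x.1 + y') * s (x.2 + y') * G (x.1 - x.2, y)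
        calc _ = h x y' * (h x y')⁻¹ *
              (marginalDensity volume h x * (marginalDensity volume h x)⁻¹) * w := by
              simp only [div_eq_mul_inv]; ring
          _ ≤ 1 * 1 * w := by gcongr <;> exact ENNReal.mul_inv_le_one _
          _ = w := by simp
    _ = ∫⁻ x, ∫⁻ y, h x y * (ρ (x.1 - x.2) * G (x.1 - x.2, y)) := by
        refine lintegral_congr fun x => lintegral_congr fun y => ?_
        rw [lintegral_mul_const _ (by fun_prop), hcorr]
    _ = ∫⁻ t : (ℝ × ℝ) × ℝ, Function.uncurry h t *
          (ρ (t.1.1 - t.1.2) * G (t.1.1 - t.1.2, t.2)) := by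
        rw [Measure.volume_eq_prod (ℝ × ℝ) ℝ, lintegral_prod _ hρG'.aemeasurable]
        rfl
    _ = ∫⁻ w, ρ w.1 * G w ∂(volume.withDensity q) := by
        rw [← hlaw, lintegral_map hρG (by fun_prop),
          lintegral_withDensity_eq_lintegral_mul _ hh (by fun_prop)]
        rfl
    _ = ∫⁻ w, q w * (ρ w.1 * G w) := lintegral_withDensity_eq_lintegral_mul _ hq hρG
    _ ≤ ∫⁻ w : ℝ × ℝ, ρ w.1 * g w.2 := by
        refine lintegral_mono fun w => ?_
        rw [mul_left_comm]
        exact mul_le_mul_right ENNReal.mul_div_le _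
    _ = 1 := by
        rw [Measure.volume_eq_prod, lintegral_prod_mul hρ.aemeasurable hg.aemeasurable, hg1,
          lintegral_autocorrelation hs hs1, one_mul]

end Bounds

/-! ### Conditionally independent versions -/

/-- If `(X, Y)` has a density, then the law of `Y` and its conditionally independent versions of
`X` is the one built from that density. -/
lemma IsCondIndepVersions.map_eq_condIndepCopies {Ω : Type*} [MeasurableSpace Ω]
    {P : Measure Ω} [IsProbabilityMeasure P] {X Y X₁ X₂ : Ω → ℝ} (hX : Measurable X)
    (hY : Measurable Y) (hX₁ : Measurable X₁) (hX₂ : Measurable X₂)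
    (hver : IsCondIndepVersions X₁ X₂ X Y P) {h : ℝ → ℝ → ENNReal}
    (hh : Measurable (Function.uncurry h))
    (hlaw : P.map (fun ω => (Y ω, X ω)) = volume.withDensity (Function.uncurry h)) :
    P.map (fun ω => (Y ω, (X₁ ω, X₂ ω))) = condIndepCopies volume volume h := by
  have := isFiniteKernel_condDensityKernel (ν := volume) hh
  have hYlaw : P.map Y = volume.withDensity (marginalDensity volume h) := by
    rw [← map_fst_withDensity hh, ← Measure.volume_eq_prod, ← hlaw,
      Measure.map_map measurable_fst (by fun_prop)]
    rfl
  have hm : ∀ᵐ y, marginalDensity volume h y ≠ ⊤ := by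
    refine ae_marginalDensity_ne_top hh ?_
    rw [← Measure.volume_eq_prod, ← hlaw]
    have := Measure.isProbabilityMeasure_map (μ := P) (f := fun ω => (Y ω, X ω)) (by fun_prop)
    exact measure_ne_top _ _
  have hcond {X' : Ω → ℝ} (hX' : Measurable X')
      (hid : IdentDistrib (fun ω => (X' ω, Y ω)) (fun ω => (X ω, Y ω)) P P) :
      condDistrib X' Y P =ᵐ[P.map Y] condDensityKernel volume h := by
    refine condDistrib_ae_eq_of_measure_eq_compProd Y hX'.aemeasurable ?_
    have hswap := (hid.comp measurable_swap).map_eq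
    rw [hYlaw, withDensity_compProd_condDensityKernel hh hm, ← Measure.volume_eq_prod, ← hlaw]
    exact hswap
  rw [← compProd_map_condDistrib (by fun_prop), condIndepCopies, ← hYlaw]
  refine Measure.compProd_congr ?_
  filter_upwards [hver.condIndep, hcond hX₁ hver.identDistrib_fst,
    hcond hX₂ hver.identDistrib_snd] with y h0 h1 h2
  rw [h0, Kernel.prod_apply, Kernel.prod_apply, h1, h2]

/-! ### Entropies and the inequality -/

/-- If `V` has under `π` the law of `W` under `P`, then the entropy of `W` can be computed as an
expectation under `π`. -/
lemma HasFiniteDiffEntropy.log_pdf_of_identDistrib {Ω T E : Type*} [MeasurableSpace Ω]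
    [MeasurableSpace T] [MeasureSpace E] {P : Measure Ω} [IsProbabilityMeasure P] {π : Measure T}
    {V : T → E} {W : Ω → E} (hW : HasFiniteDiffEntropy W P) (hVW : IdentDistrib V W π P) :
    Integrable (fun t => Real.log (pdf W P volume (V t)).toReal) π ∧
      ∫ t, Real.log (pdf W P volume (V t)).toReal ∂π = -diffEntropy W P ∧
      ∀ᵐ t ∂π, pdf W P volume (V t) ≠ 0 ∧ pdf W P volume (V t) ≠ ⊤ := by
  have := hW.hasPDF
  have hd : Measurable (pdf W P volume) := measurable_pdf W P volume
  have hlog := hVW.comp (Real.measurable_log.comp hd.ennreal_toReal)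
  refine ⟨hlog.integrable_iff.2 hW.integrable_log, hlog.integral_eq.trans ?_, ?_⟩
  · rw [diffEntropy, integral_neg, neg_neg]
    rfl
  · have := Measure.isProbabilityMeasure_map (μ := P) hVW.aemeasurable_snd
    refine ae_of_ae_map (p := fun x => pdf W P volume x ≠ 0 ∧ pdf W P volume x ≠ ⊤)
      hVW.aemeasurable_fst ?_
    rw [hVW.map_eq]
    exact ae_ne_zero_and_ne_top_of_eq_withDensity hd (map_eq_withDensity_pdf W P volume)

lemma HasFiniteDiffEntropy.lintegral_pdf {Ω E : Type*} [MeasurableSpace Ω] [MeasureSpace E]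
    {P : Measure Ω} [IsProbabilityMeasure P] {W : Ω → E} (hW : HasFiniteDiffEntropy W P) :
    ∫⁻ x, pdf W P volume x = 1 := by
  have := hW.hasPDF
  rw [pdf.lintegral_eq_measure_univ, measure_univ]

/-- The chain rule `h(U | V) = h(U, V) - h(V)`. -/
lemma condDiffEntropy_eq_sub {Ω E F : Type*} [MeasurableSpace Ω] [MeasureSpace E] [MeasureSpace F]
    {P : Measure Ω} [IsProbabilityMeasure P] {U : Ω → E} {V : Ω → F}
    (hV : HasFiniteDiffEntropy V P) (hUV : HasFiniteDiffEntropy (fun ω => (U ω, V ω)) P) :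
    condDiffEntropy U V P = diffEntropy (fun ω => (U ω, V ω)) P - diffEntropy V P := by
  obtain ⟨hi, he, hp⟩ := hUV.log_pdf_of_identDistrib (.refl hUV.hasPDF.aemeasurable')
  obtain ⟨hi', he', hp'⟩ := hV.log_pdf_of_identDistrib (.refl hV.hasPDF.aemeasurable')
  have : condDiffEntropy U V P =
      ∫ ω, -(Real.log (pdf (fun ω => (U ω, V ω)) P volume (U ω, V ω)).toReal -
        Real.log (pdf V P volume (V ω)).toReal) ∂P := by
    refine integral_congr_ae ?_
    filter_upwards [hp, hp'] with ω h1 h2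
    rw [Real.log_div (ENNReal.toReal_ne_zero.2 h1) (ENNReal.toReal_ne_zero.2 h2)]
  rw [this, integral_neg, integral_sub hi hi', he, he']
  ring

/-- The pointwise inequality: `log t ≤ t - 1` for each of the two likelihood ratios. The density `r`
of `(X₁, X₂)` cancels on the left. -/
lemma log_add_log_le_ratio_add_ratio_sub_two {f₁ f₂ s₁ s₂ g g' p₁ p₂ q r : ℝ} (hf₁ : 0 < f₁)
    (hf₂ : 0 < f₂) (hs₁ : 0 < s₁) (hs₂ : 0 < s₂) (hg : 0 < g) (hg' : 0 < g') (hp₁ : 0 < p₁)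
    (hp₂ : 0 < p₂) (hq : 0 < q) (hr : 0 < r) :
    (Real.log f₁ + Real.log f₂ + (Real.log s₁ + Real.log s₂) + Real.log g' -
        (Real.log p₁ + Real.log p₂)) + (Real.log g - Real.log q) ≤
      f₁ * f₂ / r + r * (s₁ * s₂ * (g / q)) / (p₁ * (p₂ / g')) - 2 := by
  have h1 := Real.log_le_sub_one_of_pos (show 0 < f₁ * f₂ / r by positivity)
  have h2 := Real.log_le_sub_one_of_pos
    (show 0 < r * (s₁ * s₂ * (g / q)) / (p₁ * (p₂ / g')) by positivity)
  rw [Real.log_div (by positivity) (by positivity), Real.log_mul (by positivity) (by positivity)]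
    at h1
  rw [Real.log_div (by positivity) (by positivity), Real.log_mul (by positivity) (by positivity),
    Real.log_mul (by positivity) (by positivity), Real.log_mul (by positivity) (by positivity),
    Real.log_mul (by positivity) (by positivity), Real.log_div (by positivity) (by positivity),
    Real.log_div (by positivity) (by positivity)] at h2
  linarith

/-- The entropy inequality behind the theorem, before the hypotheses on `I(X; Y)` and `h(X + Y)`
are inserted. -/
lemma diffEntropy_sub_le {Ω : Type*} [MeasurableSpace Ω] (P : Measure Ω) [IsProbabilityMeasure P]
    (X Y X₁ X₂ : Ω → ℝ)
    (hX : Measurable X) (hY : Measurable Y) (hX₁ : Measurable X₁) (hX₂ : Measurable X₂)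
    (hver : IsCondIndepVersions X₁ X₂ X Y P)
    (entX : HasFiniteDiffEntropy X P)
    (entY : HasFiniteDiffEntropy Y P)
    (entXY : HasFiniteDiffEntropy (fun ω => (X ω, Y ω)) P)
    (entAdd : HasFiniteDiffEntropy (fun ω => X ω + Y ω) P)
    (entSub : HasFiniteDiffEntropy (fun ω => (X₁ ω - X₂ ω, Y ω)) P) :
    diffEntropy (fun ω => (X₁ ω - X₂ ω, Y ω)) P + 2 * diffEntropy (fun ω => (X ω, Y ω)) P ≤
      2 * diffEntropy X P + 2 * diffEntropy Y P + 2 * diffEntropy (fun ω => X ω + Y ω) P := by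
  have := entXY.hasPDF
  have := entSub.hasPDF
  have := entY.hasPDF
  let f := pdf X P volume
  let g := pdf Y P volume
  let s := pdf (fun ω => X ω + Y ω) P volume
  let p := pdf (fun ω => (X ω, Y ω)) P volume
  let q := pdf (fun ω => (X₁ ω - X₂ ω, Y ω)) P volume
  have hf : Measurable f := measurable_pdf _ _ _
  have hg : Measurable g := measurable_pdf _ _ _
  have hs : Measurable s := measurable_pdf _ _ _
  have hp : Measurable p := measurable_pdf _ _ _
  have hq : Measurable q := measurable_pdf _ _ _
  -- The density of `(Y, X)`, and its first marginal, which is a version of the density of `Y`.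
  let h : ℝ → ℝ → ENNReal := fun y x => p (x, y)
  have hh : Measurable (Function.uncurry h) := hp.comp measurable_swap
  have hlaw : P.map (fun ω => (Y ω, X ω)) = volume.withDensity (Function.uncurry h) := by
    rw [show (fun ω => (Y ω, X ω)) = Prod.swap ∘ fun ω => (X ω, Y ω) from rfl,
      ← Measure.map_map measurable_swap (by fun_prop), map_eq_withDensity_pdf _ P volume]
    exact map_swap_withDensity hp
  let m := marginalDensity volume h
  have hm : Measurable m := measurable_marginalDensity hh
  have hYlaw : P.map Y = volume.withDensity m := by
    rw [← map_fst_withDensity hh, ← Measure.volume_eq_prod, ← hlaw,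
      Measure.map_map measurable_fst (by fun_prop)]
    rfl
  have hgm : g =ᵐ[volume] m := (pdf.eq_of_map_eq_withDensity m hm.aemeasurable).1 hYlaw
  have hm_top : ∀ᵐ y, m y ≠ ⊤ := by
    have hg_lt : ∀ᵐ y, g y < ⊤ := pdf.ae_lt_top
    filter_upwards [hgm, hg_lt] with y h1 h2
    exact h1 ▸ h2.ne
  -- The density of `((X₁, X₂), Y)`.
  let k : ℝ × ℝ → ℝ → ENNReal := fun x y => h y x.1 * (h y x.2 / m y)
  have hk : Measurable (Function.uncurry k) :=
    (hp.comp (f := fun t : (ℝ × ℝ) × ℝ => (t.1.1, t.2)) (by fun_prop)).mul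
      ((hp.comp (f := fun t : (ℝ × ℝ) × ℝ => (t.1.2, t.2)) (by fun_prop)).div (by fun_prop))
  let Z : Ω → (ℝ × ℝ) × ℝ := fun ω => ((X₁ ω, X₂ ω), Y ω)
  have hZ : Measurable Z := by fun_prop
  have hZlaw : P.map Z = volume.withDensity (Function.uncurry k) := by
    have hk' : Measurable fun z : ℝ × ℝ × ℝ => h z.1 z.2.1 * (h z.1 z.2.2 / m z.1) :=
      hk.comp measurable_swap
    rw [show Z = Prod.swap ∘ fun ω => (Y ω, (X₁ ω, X₂ ω)) from rfl,
      ← Measure.map_map measurable_swap (by fun_prop),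
      hver.map_eq_condIndepCopies hX hY hX₁ hX₂ hh hlaw,
      condIndepCopies_eq_withDensity hh hm_top, map_swap_withDensity hk']
    rfl
  have hπ : IsProbabilityMeasure (P.map Z) := Measure.isProbabilityMeasure_map hZ.aemeasurable
  let r := marginalDensity volume k
  have hr : Measurable r := measurable_marginalDensity hk
  have hr_top : ∀ᵐ x, r x ≠ ⊤ := by
    refine ae_marginalDensity_ne_top hk ?_
    rw [← Measure.volume_eq_prod, ← hZlaw]
    exact measure_ne_top _ _
  -- The law `M` of `((X₁, X₂), Y, Y')`.
  let M := condIndepCopies volume volume k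
  have hM₁ : IdentDistrib (fun z : (ℝ × ℝ) × ℝ × ℝ => (z.1, z.2.1)) Z M P := by
    refine ⟨by fun_prop, hZ.aemeasurable, ?_⟩
    rw [hZlaw]
    exact map_fst_condIndepCopies hk hr_top
  have hM₂ : IdentDistrib (fun z : (ℝ × ℝ) × ℝ × ℝ => (z.1, z.2.2)) Z M P := by
    refine ⟨by fun_prop, hZ.aemeasurable, ?_⟩
    rw [hZlaw]
    exact map_snd_condIndepCopies hk hr_top
  have hM : IsProbabilityMeasure M := by
    refine ⟨?_⟩
    have := hM₁.measure_mem_eq MeasurableSet.univ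
    simpa using this
  have hM₂₁ : IdentDistrib (fun z : (ℝ × ℝ) × ℝ × ℝ => (z.1.1, z.2.2)) (fun ω => (X ω, Y ω)) M P :=
    (hM₂.comp (u := fun t => (t.1.1, t.2)) (by fun_prop)).trans hver.identDistrib_fst
  have hM₂₂ : IdentDistrib (fun z : (ℝ × ℝ) × ℝ × ℝ => (z.1.2, z.2.2)) (fun ω => (X ω, Y ω)) M P :=
    (hM₂.comp (u := fun t => (t.1.2, t.2)) (by fun_prop)).trans hver.identDistrib_snd
  have hMY : IdentDistrib (fun z : (ℝ × ℝ) × ℝ × ℝ => z.2.2) Y M P := hM₂.comp measurable_snd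
  have hMY' : IdentDistrib (fun z : (ℝ × ℝ) × ℝ × ℝ => z.2.1) Y M P := hM₁.comp measurable_snd
  have hadd : Measurable fun t : ℝ × ℝ => t.1 + t.2 := by fun_prop
  -- Each entropy as an expectation under `M`, together with the positivity of the density.
  obtain ⟨if₁, ef₁, pf₁⟩ := entX.log_pdf_of_identDistrib
    (V := fun z : (ℝ × ℝ) × ℝ × ℝ => z.1.1) (hM₂₁.comp measurable_fst)
  obtain ⟨if₂, ef₂, pf₂⟩ := entX.log_pdf_of_identDistrib
    (V := fun z : (ℝ × ℝ) × ℝ × ℝ => z.1.2) (hM₂₂.comp measurable_fst)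
  obtain ⟨is₁, es₁, ps₁⟩ := entAdd.log_pdf_of_identDistrib
    (V := fun z : (ℝ × ℝ) × ℝ × ℝ => z.1.1 + z.2.2) (hM₂₁.comp hadd)
  obtain ⟨is₂, es₂, ps₂⟩ := entAdd.log_pdf_of_identDistrib
    (V := fun z : (ℝ × ℝ) × ℝ × ℝ => z.1.2 + z.2.2) (hM₂₂.comp hadd)
  obtain ⟨ip₁, ep₁, pp₁⟩ := entXY.log_pdf_of_identDistrib hM₂₁
  obtain ⟨ip₂, ep₂, pp₂⟩ := entXY.log_pdf_of_identDistrib hM₂₂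
  obtain ⟨ig', eg', pg'⟩ := entY.log_pdf_of_identDistrib hMY
  obtain ⟨ig, eg, pg⟩ := entY.log_pdf_of_identDistrib hMY'
  obtain ⟨iq, eq, pq⟩ := entSub.log_pdf_of_identDistrib
    (V := fun z : (ℝ × ℝ) × ℝ × ℝ => (z.1.1 - z.1.2, z.2.1))
    (hM₁.comp (u := fun t => (t.1.1 - t.1.2, t.2)) (by fun_prop))
  have pr : ∀ᵐ z ∂M, r z.1 ≠ 0 ∧ r z.1 ≠ ⊤ := by
    have hlaw_r : M.map Prod.fst = volume.withDensity r := by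
      rw [← map_fst_withDensity hk, ← Measure.volume_eq_prod, ← hZlaw, ← hM₂.map_eq,
        Measure.map_map measurable_fst (by fun_prop)]
      rfl
    have := Measure.isProbabilityMeasure_map (μ := M) (f := Prod.fst) (by fun_prop)
    exact ae_of_ae_map (p := fun x => r x ≠ 0 ∧ r x ≠ ⊤) (by fun_prop)
      (ae_ne_zero_and_ne_top_of_eq_withDensity hr hlaw_r)
  have pm : ∀ᵐ z ∂M, g z.2.2 = m z.2.2 := by
    refine ae_of_ae_map (p := fun y => g y = m y) hMY.aemeasurable_fst ?_
    rw [hMY.map_eq]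
    exact HasPDF.absolutelyContinuous.ae_le hgm
  have hkM : Measurable fun z : (ℝ × ℝ) × ℝ × ℝ => k z.1 z.2.2 :=
    hk.comp (f := fun z : (ℝ × ℝ) × ℝ × ℝ => (z.1, z.2.2)) (by fun_prop)
  have hqlaw : ((volume : Measure ((ℝ × ℝ) × ℝ)).withDensity (Function.uncurry k)).map
      (fun t => (t.1.1 - t.1.2, t.2)) = volume.withDensity q := by
    rw [← hZlaw, Measure.map_map (by fun_prop) hZ]
    exact map_eq_withDensity_pdf (fun ω => (X₁ ω - X₂ ω, Y ω)) P volume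
  have main := integral_nonpos_of_le_add_sub_two (μ := M)
    (((((if₁.add if₂).add (is₁.add is₂)).add ig').sub (ip₁.add ip₂)).add (ig.sub iq))
    (u := fun z => f z.1.1 * f z.1.2 / r z.1)
    (v := fun z => r z.1 *
      (s (z.1.1 + z.2.2) * s (z.1.2 + z.2.2) * (g z.2.1 / q (z.1.1 - z.1.2, z.2.1))) /
        k z.1 z.2.2) (by fun_prop) (by fun_prop)
    (lintegral_condIndepCopies_product_ratio_le_one hk hr_top hf entX.lintegral_pdf)
    (lintegral_condIndepCopies_sum_ratio_le_one hk hr_top hs hg hq entAdd.lintegral_pdf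
      entY.lintegral_pdf hqlaw)
    (by
      filter_upwards [pf₁, pf₂, ps₁, ps₂, pp₁, pp₂, pg', pg, pq, pr, pm] with z
        hf₁ hf₂ hs₁ hs₂ hp₁ hp₂ hg' hg hq hr hm
      have pos {a : ENNReal} (ha : a ≠ 0 ∧ a ≠ ⊤) : 0 < a.toReal := ENNReal.toReal_pos ha.1 ha.2
      simp only [k, h, ← hm, ENNReal.toReal_mul, ENNReal.toReal_div]
      exact log_add_log_le_ratio_add_ratio_sub_two (pos hf₁) (pos hf₂) (pos hs₁) (pos hs₂)
        (pos hg) (pos hg') (pos hp₁) (pos hp₂) (pos hq) (pos hr))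
  rw [integral_add' ((((if₁.add if₂).add (is₁.add is₂)).add ig').sub (ip₁.add ip₂)) (ig.sub iq),
    integral_sub' (((if₁.add if₂).add (is₁.add is₂)).add ig') (ip₁.add ip₂),
    integral_add' ((if₁.add if₂).add (is₁.add is₂)) ig',
    integral_add' (if₁.add if₂) (is₁.add is₂), integral_add' if₁ if₂, integral_add' is₁ is₂,
    integral_add' ip₁ ip₂, integral_sub' ig iq, ef₁, ef₂, es₁, es₂, ep₁, ep₂, eg', eg, eq] at main
  linarith

theorem proposition2 {Ω : Type*} [MeasurableSpace Ω] (P : Measure Ω) [IsProbabilityMeasure P]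
    (X Y X₁ X₂ : Ω → ℝ)
    (hX : Measurable X) (hY : Measurable Y) (hX₁ : Measurable X₁) (hX₂ : Measurable X₂)
    (hver : IsCondIndepVersions X₁ X₂ X Y P)
    (entX : HasFiniteDiffEntropy X P)
    (entY : HasFiniteDiffEntropy Y P)
    (entXY : HasFiniteDiffEntropy (fun ω => (X ω, Y ω)) P)
    (entAdd : HasFiniteDiffEntropy (fun ω => X ω + Y ω) P)
    (entSub : HasFiniteDiffEntropy (fun ω => (X₁ ω - X₂ ω, Y ω)) P)
    (K : ℝ) (hK : 1 ≤ K)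
    (hI : mutualInfo X Y P ≤ Real.log K)
    (hAdd : diffEntropy (fun ω => X ω + Y ω) P ≤
      1 / 2 * diffEntropy X P + 1 / 2 * diffEntropy Y P + Real.log K) :
    condDiffEntropy (fun ω => X₁ ω - X₂ ω) Y P ≤ diffEntropy X P + 4 * Real.log K := by
  have h := diffEntropy_sub_le P X Y X₁ X₂ hX hY hX₁ hX₂ hver entX entY entXY entAdd entSub
  rw [condDiffEntropy_eq_sub entY entSub]
  rw [mutualInfo] at hI
  linarith
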